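/- There is a function $h:(0,\infty)\to\mathbb{R}$ with $h(\varepsilon)=\widetilde{\Omega}(1/\sqrt{\varepsilon})$ as $\varepsilon\to 0^+$ (that is, there are constants $C>0$ and $k\in\mathbb{N}$ such that $h(\varepsilon)\ge C\,\varepsilon^{-1/2}/\big(\ln(\varepsilon^{-1/2})\big)^{k}$ for all sufficiently small $\varepsilon>0$) such that the following holds. For every $\varepsilon>0$ there is $n(\varepsilon)$ such that for every $n\ge n(\varepsilon)$ there is a nonempty bounded set $T\subset\mathbb{R}^n$ of Gaussian width $$w(T):=\mathbf{E}_{g\sim N(0,I_n)}\big[f_T(g)\big]=1,\qquad f_T(x):=\sup_{t\in T}x\cdot t,$$ with the property that every nonempty set $S\subset\mathbb{R}^n$ and every collection of real constants $\{c_s\}_{s\in S}$ satisfying $$\mathbf{E}_{g\sim N(0,I_n)}\Big[\Big|f_T(g)-\sup_{s\in S}\{g\cdot s+c_s\}\Big|\Big]\le\varepsilon$$ have $|S|\ge 2^{h(\varepsilon)}$. -/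

import Mathlib

open MeasureTheory ProbabilityTheory Filter Topology
open scoped ENNReal

noncomputable section

/-- `f = Ω̃(g)` along the filter `l` (meant for `g → ∞` along `l`): for some constant `C > 0` and
some exponent `k`, eventually `f ≥ C · g / (log g) ^ k`. -/
def IsTildeOmega (l : Filter ℝ) (f g : ℝ → ℝ) : Prop :=
  ∃ C : ℝ, 0 < C ∧ ∃ k : ℕ, ∀ᶠ x in l, C * (g x / Real.log (g x) ^ k) ≤ f x

/-- `x ↦ sup_{s ∈ S} (x · s + c_s)` (used for nonempty `S`). -/
def shiftedSup {n : ℕ} (S : Set (EuclideanSpace ℝ (Fin n))) (c : S → ℝ)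
    (x : EuclideanSpace ℝ (Fin n)) : ℝ :=
  ⨆ s : S, (inner ℝ x (s : EuclideanSpace ℝ (Fin n)) + c s)

/-- `f_T(x) = sup_{t ∈ T} x · t` (used for nonempty bounded `T`). -/
def supFun {n : ℕ} (T : Set (EuclideanSpace ℝ (Fin n))) (x : EuclideanSpace ℝ (Fin n)) : ℝ :=
  ⨆ t : T, inner ℝ x (t : EuclideanSpace ℝ (Fin n))

/-- The Gaussian width `w(T) = E f_T(g)`, `g ∼ N(0, I_n)` (used for nonempty bounded `T`, where
`f_T` is Lipschitz, hence integrable). -/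
def gaussianWidth {n : ℕ} (T : Set (EuclideanSpace ℝ (Fin n))) : ℝ :=
  ∫ g, supFun T g ∂(stdGaussian (EuclideanSpace ℝ (Fin n)))

end

/-! Take `T` to be a Euclidean ball in `q ^ 2` coordinates, normalized to width one, with `q` of
order `1 / ε`. After multiplying by `w ≤ 4 * q`, `f_T` becomes the norm of those coordinates, which
concentrates within `O(1)` of `q`. By Markov, an `ε`-approximation by a maximum of `N` affine
functions has a superlevel set `A` at height `q - 5` that agrees with the exterior of a ball of
radius about `q`, up to sets of measure `exp (-319)`.

Now shrink these coordinates by the factor `(1 + 25 / q) ^ (-1/2)`. The norm drops by about 12.5, so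
the shrunk Gaussian point should rarely lie in `A`. The tiny exceptional set stays small under the
shrunk law, because that law has a density with second moment at most `exp (q ^ 2 * l ^ 2 / 2)`, a
constant for `l = 25 / q` (`measureReal_preimage_scaleCoords_le`).

But `A` is a union of `N` half-spaces, and such a union resists shrinking. Split it into cells
according to the half-space entered most deeply. Translating a cell along its own normal stays
inside the cell and offsets the loss from shrinking. Outside a set of small measure the points have
normal component at most `T`, about `√(log N)`, so the Cameron–Martin cost is `exp (-O(l * T ^ 2))`,
that is `exp (-O(log N / q))` (`measureReal_halfspaces_scaleCoords_ge`). If `log N` were small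
compared with `q`, `A` would keep a constant share of its mass, a contradiction. Hence `log N` is at
least of order `1 / ε`, more than the required `1 / √ε`. -/

/-! ### Gaussian change of variables: translations and coordinate scalings. -/

theorem lintegral_pi_prod_eq_prod {ι : Type*} [Fintype ι] {α : ι → Type*}
    [∀ i, MeasurableSpace (α i)] (μ : ∀ i, Measure (α i)) [∀ i, IsProbabilityMeasure (μ i)]
    {f : ∀ i, α i → ℝ≥0∞} (hf : ∀ i, Measurable (f i)) :
    ∫⁻ x, ∏ i, f i (x i) ∂Measure.pi μ = ∏ i, ∫⁻ y, f i y ∂μ i := by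
  refine (lintegral_prod_eq_prod_lintegral_of_indepFun Finset.univ
    (fun i (x : ∀ i, α i) => f i (x i)) (iIndepFun_pi fun i => (hf i).aemeasurable)
    fun i => (hf i).comp (measurable_pi_apply i)).trans ?_
  refine Finset.prod_congr rfl fun i _ => ?_
  exact (measurePreserving_eval μ i).lintegral_comp (hf i)

theorem pi_withDensity_eq {ι : Type*} [Fintype ι] {α : ι → Type*}
    [∀ i, MeasurableSpace (α i)] (μ : ∀ i, Measure (α i)) [∀ i, IsProbabilityMeasure (μ i)]
    {f : ∀ i, α i → ℝ≥0∞} (hf : ∀ i, Measurable (f i))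
    [∀ i, IsProbabilityMeasure ((μ i).withDensity (f i))] :
    Measure.pi (fun i => (μ i).withDensity (f i)) =
      (Measure.pi μ).withDensity fun x => ∏ i, f i (x i) := by
  classical
  refine Measure.pi_eq fun s hs => ?_
  rw [withDensity_apply _ (MeasurableSet.univ_pi hs), ← lintegral_indicator (.univ_pi hs)]
  have key : (Set.univ.pi s).indicator (fun x : ∀ i, α i => ∏ i, f i (x i)) =
      fun x => ∏ i, (s i).indicator (f i) (x i) := by
    funext x
    by_cases hx : x ∈ Set.univ.pi s
    · rw [Set.indicator_of_mem hx]
      exact Finset.prod_congr rfl fun i _ =>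
        (Set.indicator_of_mem (hx i (Set.mem_univ i)) (f i)).symm
    · rw [Set.indicator_of_notMem hx]
      simp only [Set.mem_pi, Set.mem_univ, forall_const, not_forall] at hx
      obtain ⟨i, hi⟩ := hx
      exact (Finset.prod_eq_zero (Finset.mem_univ i) (Set.indicator_of_notMem hi (f i))).symm
  rw [key, lintegral_pi_prod_eq_prod μ fun i => (hf i).indicator (hs i)]
  refine Finset.prod_congr rfl fun i _ => ?_
  rw [lintegral_indicator (hs i), withDensity_apply _ (hs i)]

/-- The density of the law of `r * x + a` with respect to the law of `x`, where `x ∼ N(0, 1)`. -/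
noncomputable def affineDensity (r a x : ℝ) : ℝ :=
  r⁻¹ * Real.exp (x ^ 2 / 2 - (x - a) ^ 2 / (2 * r ^ 2))

@[fun_prop]
theorem measurable_affineDensity (r a : ℝ) : Measurable (affineDensity r a) := by
  unfold affineDensity
  fun_prop

theorem affineDensity_nonneg {r : ℝ} (hr : 0 < r) (a x : ℝ) : 0 ≤ affineDensity r a x := by
  unfold affineDensity
  positivity

theorem gaussianReal_map_affine {r : ℝ} (hr : 0 < r) (a : ℝ) :
    (gaussianReal 0 1).map (fun x => r * x + a) =
      (gaussianReal 0 1).withDensity fun x => ENNReal.ofReal (affineDensity r a x) := by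
  have h1 : (gaussianReal 0 1).map (fun x => r * x + a) =
      gaussianReal a (.mk (r ^ 2) (sq_nonneg r)) := by
    have := Measure.map_map (μ := gaussianReal 0 1) (f := fun x => r * x) (g := fun x => x + a)
      (by fun_prop) (by fun_prop)
    rw [gaussianReal_map_const_mul, gaussianReal_map_add_const] at this
    simpa [Function.comp_def] using this.symm
  have hv : NNReal.mk (r ^ 2) (sq_nonneg r) ≠ 0 := by
    simpa [← NNReal.coe_ne_zero] using hr.ne'
  rw [h1, gaussianReal_of_var_ne_zero _ hv, gaussianReal_of_var_ne_zero _ one_ne_zero,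
    ← withDensity_mul _ (measurable_gaussianPDF _ _) (by fun_prop)]
  congr 1
  funext x
  simp only [Pi.mul_apply, gaussianPDF]
  rw [← ENNReal.ofReal_mul (gaussianPDFReal_nonneg _ _ _)]
  congr 1
  simp only [gaussianPDFReal, affineDensity, NNReal.coe_mk, NNReal.coe_one, sub_zero, mul_one]
  rw [Real.sqrt_mul (by positivity), Real.sqrt_sq hr.le, mul_inv]
  have : Real.exp (-(x - a) ^ 2 / (2 * r ^ 2)) =
      Real.exp (-x ^ 2 / 2) * Real.exp (x ^ 2 / 2 - (x - a) ^ 2 / (2 * r ^ 2)) := by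
    rw [← Real.exp_add]
    congr 1
    ring
  rw [this]
  ring

theorem stdGaussian_map_affine {ι : Type*} [Fintype ι] {r : ι → ℝ} (hr : ∀ i, 0 < r i)
    (a : ι → ℝ) :
    (stdGaussian (EuclideanSpace ℝ ι)).map
        (fun x => WithLp.toLp 2 fun i => r i * x i + a i) =
      (stdGaussian (EuclideanSpace ℝ ι)).withDensity
        fun x => ENNReal.ofReal (∏ i, affineDensity (r i) (a i) (x i)) := by
  have hm : ∀ i, Measurable fun x => ENNReal.ofReal (affineDensity (r i) (a i) x) :=
    fun i => by fun_prop
  have hp : ∀ i, IsProbabilityMeasure ((gaussianReal 0 1).withDensity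
      fun x => ENNReal.ofReal (affineDensity (r i) (a i) x)) := fun i => by
    rw [← gaussianReal_map_affine (hr i)]
    exact Measure.isProbabilityMeasure_map (by fun_prop)
  have h := Measure.pi_map_pi (μ := fun _ : ι => gaussianReal 0 1)
    (f := fun i x => r i * x + a i) fun i => by fun_prop
  simp_rw [gaussianReal_map_affine (hr _)] at h
  rw [pi_withDensity_eq _ hm] at h
  rw [← map_pi_eq_stdGaussian, Measure.map_map (by fun_prop) (by fun_prop)]
  have h2 := congrArg (Measure.map (WithLp.toLp 2)) h
  rw [Measure.map_map (by fun_prop) (by fun_prop)] at h2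
  refine h2.trans ?_
  have hT : Measurable (WithLp.toLp 2 : (ι → ℝ) → EuclideanSpace ℝ ι) := by fun_prop
  ext s hs
  rw [Measure.map_apply hT hs, withDensity_apply _ (hT hs), withDensity_apply _ hs,
    setLIntegral_map hs (by fun_prop) hT]
  refine lintegral_congr fun x => ?_
  rw [ENNReal.ofReal_prod_of_nonneg fun i _ => affineDensity_nonneg (hr i) _ _]

/-- The **Cameron–Martin formula** for a standard Gaussian vector. -/
theorem lintegral_stdGaussian_add {ι : Type*} [Fintype ι] (a : EuclideanSpace ℝ ι)
    {h : EuclideanSpace ℝ ι → ℝ≥0∞} (hh : Measurable h) :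
    ∫⁻ x, h (x + a) ∂stdGaussian (EuclideanSpace ℝ ι) =
      ∫⁻ x, ENNReal.ofReal (Real.exp (inner ℝ x a - ‖a‖ ^ 2 / 2)) * h x
        ∂stdGaussian (EuclideanSpace ℝ ι) := by
  have := stdGaussian_map_affine (r := fun _ : ι => 1) (fun _ => one_pos) (fun i => a i)
  have hm : Measurable fun x : EuclideanSpace ℝ ι => WithLp.toLp 2 fun i => 1 * x i + a i := by
    fun_prop
  have h2 := lintegral_map (μ := stdGaussian (EuclideanSpace ℝ ι)) hh hm
  rw [this, lintegral_withDensity_eq_lintegral_mul _ (by fun_prop) hh] at h2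
  have h3 : ∀ x : EuclideanSpace ℝ ι, WithLp.toLp 2 (fun i => 1 * x i + a i) = x + a := by
    intro x
    ext i
    simp
  simp only [h3] at h2
  rw [← h2]
  refine lintegral_congr fun x => ?_
  simp only [Pi.mul_apply]
  congr 2
  simp only [affineDensity, inv_one, one_mul]
  rw [← Real.exp_sum, EuclideanSpace.norm_sq_eq]
  congr 1
  simp only [PiLp.inner_apply, RCLike.inner_apply, conj_trivial, Real.norm_eq_abs, sq_abs]
  rw [Finset.sum_div, ← Finset.sum_sub_distrib]
  refine Finset.sum_congr rfl fun i _ => ?_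
  ring

/-- The linear map multiplying the coordinates in `J` by `r`. -/
noncomputable def scaleCoords {ι : Type*} [DecidableEq ι] (J : Finset ι) (r : ℝ)
    (x : EuclideanSpace ℝ ι) : EuclideanSpace ℝ ι :=
  WithLp.toLp 2 fun i => (if i ∈ J then r else 1) * x i

/-- The sum of the squares of the coordinates in `J`. -/
noncomputable def sumSq {ι : Type*} (J : Finset ι) (x : EuclideanSpace ℝ ι) : ℝ :=
  ∑ i ∈ J, x i ^ 2

@[fun_prop]
theorem measurable_scaleCoords {ι : Type*} [Fintype ι] [DecidableEq ι] (J : Finset ι) (r : ℝ) :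
    Measurable (scaleCoords J r) := by
  unfold scaleCoords
  fun_prop

@[fun_prop]
theorem measurable_sumSq {ι : Type*} [Fintype ι] (J : Finset ι) :
    Measurable (sumSq J) := by
  unfold sumSq
  fun_prop

theorem lintegral_stdGaussian_scaleCoords {ι : Type*} [Fintype ι] [DecidableEq ι] (J : Finset ι)
    {l : ℝ} (hl : -1 < l) {h : EuclideanSpace ℝ ι → ℝ≥0∞} (hh : Measurable h) :
    ∫⁻ x, h (scaleCoords J (√(1 + l))⁻¹ x) ∂stdGaussian (EuclideanSpace ℝ ι) =
      ∫⁻ x, ENNReal.ofReal (√(1 + l) ^ J.card * Real.exp (-(l * sumSq J x) / 2)) * h x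
        ∂stdGaussian (EuclideanSpace ℝ ι) := by
  have hs : 0 < √(1 + l) := Real.sqrt_pos.2 (by linarith)
  have := stdGaussian_map_affine (r := fun i : ι => if i ∈ J then (√(1 + l))⁻¹ else 1)
    (fun i => by split_ifs <;> positivity) (fun i => 0)
  have hm : Measurable fun x : EuclideanSpace ℝ ι =>
      WithLp.toLp 2 fun i => (if i ∈ J then (√(1 + l))⁻¹ else 1) * x i + 0 := by
    fun_prop
  have h2 := lintegral_map (μ := stdGaussian (EuclideanSpace ℝ ι)) hh hm
  rw [this, lintegral_withDensity_eq_lintegral_mul _ (by fun_prop) hh] at h2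
  simp only [add_zero] at h2
  refine h2.symm.trans (lintegral_congr fun x => ?_)
  simp only [Pi.mul_apply]
  congr 2
  have hi : ∀ i, affineDensity (if i ∈ J then (√(1 + l))⁻¹ else 1) 0 (x i) =
      if i ∈ J then √(1 + l) * Real.exp (-(l * x i ^ 2) / 2) else 1 := by
    intro i
    unfold affineDensity
    split_ifs
    · rw [inv_inv, inv_pow, Real.sq_sqrt (by linarith)]
      congr 2
      have : 1 + l ≠ 0 := by linarith
      field_simp
      ring
    · simp
  simp_rw [hi]
  rw [Finset.prod_ite_mem, Finset.univ_inter, Finset.prod_mul_distrib, Finset.prod_const,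
    ← Real.exp_sum]
  congr 2
  rw [sumSq, Finset.mul_sum, ← Finset.sum_neg_distrib, Finset.sum_div]

/-! ### Tail bounds for linear forms and for sums of squares. -/

/-- Markov's inequality, applied below to densities of tilted Gaussians: a set on which such a
density is large must be small. -/
theorem measureReal_le_inv_of_lintegral_le_one {Ω : Type*} [MeasurableSpace Ω] {μ : Measure Ω}
    {A : Set Ω} {f : Ω → ℝ} (hf : Measurable f) {c : ℝ} (hc : 0 < c) (hA : ∀ x ∈ A, c ≤ f x)
    (hint : ∫⁻ x, ENNReal.ofReal (f x) ∂μ ≤ 1) : μ.real A ≤ c⁻¹ := by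
  have h1 := mul_meas_ge_le_lintegral (μ := μ) (f := fun x => ENNReal.ofReal (f x))
    (by fun_prop) (ENNReal.ofReal c)
  have h2 : ENNReal.ofReal c * μ A ≤ 1 := by
    refine le_trans ?_ (h1.trans hint)
    gcongr
    exact fun x hx => ENNReal.ofReal_le_ofReal (hA x hx)
  have h3 := ENNReal.toReal_mono ENNReal.one_ne_top h2
  rw [ENNReal.toReal_mul, ENNReal.toReal_ofReal hc.le, ENNReal.toReal_one] at h3
  rw [inv_eq_one_div, le_div_iff₀ hc, mul_comm]
  exact h3

theorem stdGaussian_tail {ι : Type*} [Fintype ι] {u : EuclideanSpace ℝ ι} (hu : ‖u‖ ≤ 1) {T : ℝ}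
    (hT : 0 ≤ T) :
    (stdGaussian (EuclideanSpace ℝ ι)).real {x | T < inner ℝ x u} ≤ Real.exp (-T ^ 2 / 2) := by
  have h := lintegral_stdGaussian_add (T • u) (h := fun _ => 1) measurable_const
  simp only [mul_one, lintegral_const, measure_univ] at h
  have := measureReal_le_inv_of_lintegral_le_one
    (μ := stdGaussian (EuclideanSpace ℝ ι)) (A := {x | T < inner ℝ x u})
    (by fun_prop) (Real.exp_pos (T ^ 2 / 2)) (fun x hx => ?_) h.ge
  · rwa [← Real.exp_neg, ← neg_div] at this
  · rw [Real.exp_le_exp, inner_smul_right, norm_smul, mul_pow, Real.norm_eq_abs, sq_abs]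
    have h1 : ‖u‖ ^ 2 ≤ 1 := by nlinarith [norm_nonneg u]
    have h2 : T < inner ℝ x u := hx
    nlinarith [sq_nonneg T]

theorem exp_sub_sq_le_one_add {l : ℝ} (hl : -(1 / 4) ≤ l) : Real.exp (l - l ^ 2) ≤ 1 + l := by
  rcases le_total 0 l with h | h
  · rw [← Real.le_log_iff_exp_le (by linarith)]
    refine le_trans ?_ (Real.one_sub_inv_le_log_of_pos (by linarith))
    rw [le_sub_iff_add_le, ← le_sub_iff_add_le', inv_le_iff_one_le_mul₀ (by linarith)]
    nlinarith [pow_nonneg h 3]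
  · have h1 := Real.quadratic_le_exp_of_nonneg (x := -(l - l ^ 2)) (by nlinarith)
    have h2 : Real.exp (l - l ^ 2) * Real.exp (-(l - l ^ 2)) = 1 := by
      rw [← Real.exp_add]; simp
    have h3 : 1 ≤ (1 + l) * (1 + -(l - l ^ 2) + (-(l - l ^ 2)) ^ 2 / 2) := by
      have : 0 ≤ l ^ 2 * (1 / 2 + l / 2 - l ^ 2 / 2 + l ^ 3 / 2) := by
        apply mul_nonneg (sq_nonneg l)
        nlinarith [sq_nonneg l, mul_nonneg (neg_nonneg.2 h) (sq_nonneg l)]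
      nlinarith
    have h4 := Real.exp_pos (l - l ^ 2)
    have h5 := Real.exp_pos (-(l - l ^ 2))
    have h6 : 1 ≤ (1 + l) * Real.exp (-(l - l ^ 2)) :=
      h3.trans (mul_le_mul_of_nonneg_left h1 (by linarith))
    nlinarith

theorem exp_le_sqrt_one_add_pow {l : ℝ} (hl : -(1 / 4) ≤ l) (m : ℕ) :
    Real.exp (m * ((l - l ^ 2) / 2)) ≤ √(1 + l) ^ m := by
  rw [Real.exp_nat_mul]
  gcongr
  rw [Real.exp_half]
  exact Real.sqrt_le_sqrt (exp_sub_sq_le_one_add hl)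

theorem lintegral_stdGaussian_exp_sumSq {ι : Type*} [Fintype ι] (J : Finset ι)
    {l : ℝ} (hl : -1 < l) :
    ∫⁻ x, ENNReal.ofReal (√(1 + l) ^ J.card * Real.exp (-(l * sumSq J x) / 2))
      ∂stdGaussian (EuclideanSpace ℝ ι) = 1 := by
  classical
  have h := lintegral_stdGaussian_scaleCoords J hl (h := fun _ => 1) measurable_const
  simpa using h.symm

/-- Chernoff's method: the tilted density has mass one, and it is at least `exp v` on `A`. The two
tails below take `l = ± C / (2 * q)`. -/
theorem measureReal_sumSq_tail {ι : Type*} [Fintype ι] {J : Finset ι} {l v : ℝ}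
    (hl : -(1 / 4) ≤ l) {A : Set (EuclideanSpace ℝ ι)}
    (hA : ∀ x ∈ A, v ≤ J.card * ((l - l ^ 2) / 2) - l * sumSq J x / 2) :
    (stdGaussian (EuclideanSpace ℝ ι)).real A ≤ Real.exp (-v) := by
  rw [Real.exp_neg]
  refine measureReal_le_inv_of_lintegral_le_one (by fun_prop) (Real.exp_pos v) (fun x hx => ?_)
    (lintegral_stdGaussian_exp_sumSq J (by linarith : -1 < l)).le
  refine (Real.exp_le_exp.2 (hA x hx)).trans ?_
  rw [sub_eq_add_neg, Real.exp_add, neg_div]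
  gcongr
  exact exp_le_sqrt_one_add_pow hl _

theorem measureReal_sumSq_lower_tail {ι : Type*} [Fintype ι] {J : Finset ι} {q C : ℝ}
    (hq : 0 < q) (hJ : (J.card : ℝ) = q ^ 2) (hC : 0 ≤ C) {A : Set (EuclideanSpace ℝ ι)}
    (hA : ∀ x ∈ A, sumSq J x ≤ q ^ 2 - C * q) :
    (stdGaussian (EuclideanSpace ℝ ι)).real A ≤ Real.exp (-(C ^ 2 / 8)) := by
  have hl : 0 ≤ C / (2 * q) := by positivity
  refine measureReal_sumSq_tail (J := J) (l := C / (2 * q)) (by linarith) fun x hx => ?_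
  have h1 := mul_le_mul_of_nonneg_left (hA x hx) hl
  have h2 : q ^ 2 * ((C / (2 * q) - (C / (2 * q)) ^ 2) / 2)
      - C / (2 * q) * (q ^ 2 - C * q) / 2 = C ^ 2 / 8 := by
    field_simp
    ring
  rw [hJ]
  linarith

theorem measureReal_sumSq_upper_tail {ι : Type*} [Fintype ι] {J : Finset ι} {q C : ℝ}
    (hq : 0 < q) (hJ : (J.card : ℝ) = q ^ 2) (hC : 0 ≤ C) (hCq : 2 * C ≤ q)
    {A : Set (EuclideanSpace ℝ ι)} (hA : ∀ x ∈ A, q ^ 2 + C * q ≤ sumSq J x) :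
    (stdGaussian (EuclideanSpace ℝ ι)).real A ≤ Real.exp (-(C ^ 2 / 8)) := by
  have hl : 0 ≤ C / (2 * q) := by positivity
  have hl' : C / (2 * q) ≤ 1 / 4 := by
    rw [div_le_div_iff₀ (by positivity) (by norm_num)]
    linarith
  refine measureReal_sumSq_tail (J := J) (l := -(C / (2 * q))) (by linarith) fun x hx => ?_
  have h1 := mul_le_mul_of_nonneg_left (hA x hx) hl
  have h2 : q ^ 2 * ((-(C / (2 * q)) - (-(C / (2 * q))) ^ 2) / 2)
      + C / (2 * q) * (q ^ 2 + C * q) / 2 = C ^ 2 / 8 := by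
    field_simp
    ring
  rw [hJ]
  linarith

/-! ### Comparison of the shrunk Gaussian with the original one. -/

/-- The law of `scaleCoords J (√(1 + l))⁻¹ g` is controlled by the law of `g` up to an error. -/
theorem measureReal_preimage_scaleCoords_le {ι : Type*} [Fintype ι] [DecidableEq ι] {J : Finset ι}
    {l : ℝ} (hl : 0 ≤ l) {K : ℝ} (hK : 0 < K) {A : Set (EuclideanSpace ℝ ι)}
    (hA : MeasurableSet A) :
    (stdGaussian (EuclideanSpace ℝ ι)).real (scaleCoords J (√(1 + l))⁻¹ ⁻¹' A) ≤
      K * (stdGaussian (EuclideanSpace ℝ ι)).real A + Real.exp (J.card * l ^ 2 / 2) / K := by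
  set γ := stdGaussian (EuclideanSpace ℝ ι)
  have h := lintegral_stdGaussian_scaleCoords J (by linarith : -1 < l)
    (h := A.indicator fun _ => 1) (measurable_const.indicator hA)
  have e1 : ∀ x, A.indicator (fun _ => (1 : ℝ≥0∞)) (scaleCoords J (√(1 + l))⁻¹ x) =
      (scaleCoords J (√(1 + l))⁻¹ ⁻¹' A).indicator (fun _ => 1) x := fun x => rfl
  simp_rw [e1] at h
  rw [lintegral_indicator_const ((measurable_scaleCoords J _) hA), one_mul] at h
  set W := Real.exp (J.card * l ^ 2 / 2)
  have hW : 0 < W := Real.exp_pos _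
  set ρ := fun x : EuclideanSpace ℝ ι =>
    √(1 + l) ^ J.card * Real.exp (-(l * sumSq J x) / 2) with hρ
  set σ := fun x : EuclideanSpace ℝ ι =>
    √(1 + 2 * l) ^ J.card * Real.exp (-(2 * l * sumSq J x) / 2) with hσ
  -- Squaring the density doubles `l` in the exponent, so the square is a multiple of the density
  -- `σ` with parameter `2 * l`. The multiple is at most `W` because `(1 + l) ^ 2 ≤ (1 + l ^ 2) * (1
  -- + 2 * l)`.
  have hρσ : ∀ x, ρ x ^ 2 ≤ W * σ x := by
    intro x
    have h1 : √(1 + l) ^ 2 ≤ Real.exp (l ^ 2 / 2) * √(1 + 2 * l) := by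
      rw [Real.sq_sqrt (by linarith), Real.exp_half, ← Real.sqrt_mul (Real.exp_pos _).le]
      apply Real.le_sqrt_of_sq_le
      have := Real.add_one_le_exp (l ^ 2)
      nlinarith [pow_nonneg hl 3]
    have h2 : (√(1 + l) ^ 2) ^ J.card ≤ W * √(1 + 2 * l) ^ J.card := by
      refine (pow_le_pow_left₀ (by positivity) h1 _).trans_eq ?_
      rw [mul_pow, ← Real.exp_nat_mul, ← mul_div_assoc]
    have h3 : Real.exp (-(l * sumSq J x) / 2) ^ 2 = Real.exp (-(2 * l * sumSq J x) / 2) := by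
      rw [← Real.exp_nat_mul]
      congr 1
      push_cast
      ring
    calc ρ x ^ 2 = (√(1 + l) ^ 2) ^ J.card * Real.exp (-(2 * l * sumSq J x) / 2) := by
          rw [← h3, hρ]; ring
      _ ≤ W * √(1 + 2 * l) ^ J.card * Real.exp (-(2 * l * sumSq J x) / 2) := by gcongr
      _ = W * σ x := by rw [hσ]; ring
  have hσ0 : ∀ x, 0 ≤ σ x := fun x => by positivity
  have hσ1 : ∫⁻ x, ENNReal.ofReal (σ x) ∂γ = 1 :=
    lintegral_stdGaussian_exp_sumSq J (by linarith : -1 < 2 * l)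
  have hbound : γ (scaleCoords J (√(1 + l))⁻¹ ⁻¹' A) ≤
      ENNReal.ofReal K * γ A + ENNReal.ofReal (W / K) := by
    rw [h]
    calc _ ≤ ∫⁻ x, (A.indicator (fun _ => ENNReal.ofReal K) x +
            ENNReal.ofReal (W / K) * ENNReal.ofReal (σ x)) ∂γ := by
          refine lintegral_mono fun x => ?_
          by_cases hx : x ∈ A
          · rw [Set.indicator_of_mem hx, Set.indicator_of_mem hx, mul_one,
              ← ENNReal.ofReal_mul (by positivity),
              ← ENNReal.ofReal_add hK.le (mul_nonneg (by positivity) (hσ0 x))]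
            refine ENNReal.ofReal_le_ofReal ?_
            change ρ x ≤ _
            have h1 : ρ x ^ 2 / K ≤ W / K * σ x := by
              rw [div_mul_eq_mul_div]
              gcongr
              exact hρσ x
            -- Truncation at `K`: where `ρ` exceeds `K`, it is at most `ρ ^ 2 / K`.
            have h2 : ρ x ≤ K + ρ x ^ 2 / K := by
              rw [← sub_nonneg]
              have : K + ρ x ^ 2 / K - ρ x = ((ρ x - K / 2) ^ 2 + 3 / 4 * K ^ 2) / K := by
                field_simp
                ring
              rw [this]
              positivity
            linarith
          · simp [hx]
      _ = _ := by
          rw [lintegral_add_left (measurable_const.indicator hA), lintegral_indicator_const hA,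
            lintegral_const_mul' _ _ ENNReal.ofReal_ne_top, hσ1, mul_one]
  have := ENNReal.toReal_mono (by finiteness) hbound
  rw [ENNReal.toReal_add (by finiteness) (by finiteness), ENNReal.toReal_mul,
    ENNReal.toReal_ofReal hK.le, ENNReal.toReal_ofReal (by positivity)] at this
  exact this

section scaleCoords

variable {ι : Type*} [Fintype ι] [DecidableEq ι] (J : Finset ι)

theorem inner_scaleCoords (r : ℝ) (x y : EuclideanSpace ℝ ι) :
    inner ℝ (scaleCoords J r x) y =
      inner ℝ x y - (1 - r) * inner ℝ x (scaleCoords Jᶜ 0 y) := by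
  simp only [PiLp.inner_apply, RCLike.inner_apply, conj_trivial, scaleCoords, Finset.mem_compl]
  rw [Finset.mul_sum, ← Finset.sum_sub_distrib]
  refine Finset.sum_congr rfl fun i _ => ?_
  by_cases h : i ∈ J
  · simp [h]; ring
  · simp [h]

theorem norm_scaleCoords_zero_le (y : EuclideanSpace ℝ ι) : ‖scaleCoords J 0 y‖ ≤ ‖y‖ := by
  rw [EuclideanSpace.norm_eq, EuclideanSpace.norm_eq]
  refine Real.sqrt_le_sqrt (Finset.sum_le_sum fun i _ => ?_)
  simp only [scaleCoords]
  split_ifs <;> simp [sq_nonneg]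

end scaleCoords

/-! ### Unions of few half-spaces under shrinking. -/

/-- A translate of a set by `a` has comparable Gaussian measure if `⟪x, a⟫` is bounded above on
the set. -/
theorem exp_mul_measureReal_le_of_add_mem {ι : Type*} [Fintype ι] (a : EuclideanSpace ℝ ι)
    {A C : Set (EuclideanSpace ℝ ι)} (hA : MeasurableSet A)
    (hAC : ∀ x ∈ A, x + a ∈ C) {b : ℝ} (hb : ∀ x ∈ A, inner ℝ x a ≤ b) :
    Real.exp (-(b + ‖a‖ ^ 2 / 2)) * (stdGaussian (EuclideanSpace ℝ ι)).real A ≤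
      (stdGaussian (EuclideanSpace ℝ ι)).real C := by
  set γ := stdGaussian (EuclideanSpace ℝ ι)
  have h := lintegral_stdGaussian_add (-a) (h := A.indicator fun _ => 1)
    (measurable_const.indicator hA)
  have e1 : ∀ x, A.indicator (fun _ => (1 : ℝ≥0∞)) (x + -a) =
      ((fun x => x + -a) ⁻¹' A).indicator (fun _ => 1) x := fun x => rfl
  simp_rw [e1] at h
  rw [lintegral_indicator_const ((measurable_add_const (-a)) hA), one_mul] at h
  have h1 : ENNReal.ofReal (Real.exp (-(b + ‖a‖ ^ 2 / 2))) * γ A ≤ γ C := by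
    calc _ = ∫⁻ x, A.indicator (fun _ => ENNReal.ofReal (Real.exp (-(b + ‖a‖ ^ 2 / 2)))) x ∂γ :=
          (lintegral_indicator_const hA _).symm
      _ ≤ γ ((fun x => x + -a) ⁻¹' A) := by
          rw [h]
          refine lintegral_mono fun x => ?_
          by_cases hx : x ∈ A
          · rw [Set.indicator_of_mem hx, Set.indicator_of_mem hx, mul_one]
            refine ENNReal.ofReal_le_ofReal (Real.exp_le_exp.2 ?_)
            rw [inner_neg_right, norm_neg]
            linarith [hb x hx]
          · simp [hx]
      _ ≤ γ C := by
          refine measure_mono fun x hx => ?_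
          simpa using hAC _ hx
  have := ENNReal.toReal_mono (by finiteness) h1
  rwa [ENNReal.toReal_mul, ENNReal.toReal_ofReal (Real.exp_pos _).le] at this

/-- The points lying outside the `i`-th half-space, for which `i` is the first index maximizing
the distance to the half-spaces. -/
def firstMaxCell {ι : Type*} [Fintype ι] {N : ℕ} (u : Fin N → EuclideanSpace ℝ ι)
    (t : Fin N → ℝ) (i : Fin N) : Set (EuclideanSpace ℝ ι) :=
  {x | t i < inner ℝ x (u i)} ∩ (⋂ j, {x | inner ℝ x (u j) - t j ≤ inner ℝ x (u i) - t i}) ∩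
    ⋂ j, ⋂ _ : j < i, {x | inner ℝ x (u j) - t j < inner ℝ x (u i) - t i}

section firstMaxCell

variable {ι : Type*} [Fintype ι] {N : ℕ} {u : Fin N → EuclideanSpace ℝ ι} {t : Fin N → ℝ}

theorem measurableSet_firstMaxCell (i : Fin N) : MeasurableSet (firstMaxCell u t i) := by
  refine ((measurableSet_lt (by fun_prop) (by fun_prop)).inter
    (.iInter fun j => measurableSet_le (by fun_prop) (by fun_prop))).inter
    (.iInter fun j => .iInter fun _ => measurableSet_lt (by fun_prop) (by fun_prop))

theorem mem_firstMaxCell {i : Fin N} {x : EuclideanSpace ℝ ι} :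
    x ∈ firstMaxCell u t i ↔ t i < inner ℝ x (u i) ∧
      (∀ j, inner ℝ x (u j) - t j ≤ inner ℝ x (u i) - t i) ∧
      ∀ j < i, inner ℝ x (u j) - t j < inner ℝ x (u i) - t i := by
  simp [firstMaxCell, and_assoc]

theorem pairwise_disjoint_firstMaxCell :
    Pairwise fun i j => Disjoint (firstMaxCell u t i) (firstMaxCell u t j) := by
  intro i j hij
  rw [Set.disjoint_left]
  intro x hi hj
  rw [mem_firstMaxCell] at hi hj
  rcases lt_or_gt_of_ne hij with h | h
  · exact absurd (hj.2.2 i h) (not_lt.2 (hi.2.1 j))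
  · exact absurd (hi.2.2 j h) (not_lt.2 (hj.2.1 i))

theorem exists_mem_firstMaxCell {x : EuclideanSpace ℝ ι} (hx : ∃ i, t i < inner ℝ x (u i)) :
    ∃ i, x ∈ firstMaxCell u t i := by
  obtain ⟨i₀, hi₀⟩ := hx
  have : Nonempty (Fin N) := ⟨i₀⟩
  obtain ⟨k, hk⟩ := Finite.exists_max fun i => inner ℝ x (u i) - t i
  let I := Finset.univ.filter fun i => ∀ j, inner ℝ x (u j) - t j ≤ inner ℝ x (u i) - t i
  have hI : I.Nonempty := ⟨k, by simpa [I] using hk⟩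
  have hmem : ∀ j, inner ℝ x (u j) - t j ≤ inner ℝ x (u (I.min' hI)) - t (I.min' hI) := by
    simpa [I] using I.min'_mem hI
  refine ⟨I.min' hI, mem_firstMaxCell.2 ⟨?_, hmem, fun j hj => ?_⟩⟩
  · linarith [hmem i₀]
  · refine lt_of_le_of_ne (hmem j) fun he => ?_
    have : j ∈ I := by simpa [I, he] using hmem
    exact absurd (I.min'_le j this) (not_le.2 hj)

/-- For normals of length one or zero, Cauchy–Schwarz shows that a move along `u i` raises the
`i`-th excess at least as much as any other. The translated cells therefore stay disjoint. -/
theorem add_smul_mem_firstMaxCell (hu : ∀ i, u i = 0 ∨ ‖u i‖ = 1) {i : Fin N} {τ : ℝ}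
    (hτ : 0 ≤ τ) {x : EuclideanSpace ℝ ι} (hx : x ∈ firstMaxCell u t i) :
    x + τ • u i ∈ firstMaxCell u t i := by
  have hij : ∀ j, inner ℝ (u i) (u j) ≤ inner ℝ (u i) (u i) := by
    intro j
    rcases hu i with h | h
    · simp [h]
    · rw [real_inner_self_eq_norm_sq, h]
      refine (real_inner_le_norm _ _).trans ?_
      rcases hu j with h' | h' <;> simp [h, h']
  have hτij : ∀ j, τ * inner ℝ (u i) (u j) ≤ τ * inner ℝ (u i) (u i) := fun j =>
    mul_le_mul_of_nonneg_left (hij j) hτ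
  rw [mem_firstMaxCell] at hx ⊢
  simp only [inner_add_left, real_inner_smul_left]
  refine ⟨?_, fun j => by linarith [hx.2.1 j, hτij j], fun j hj => by
    linarith [hx.2.2 j hj, hτij j]⟩
  have : 0 ≤ τ * inner ℝ (u i) (u i) := mul_nonneg hτ real_inner_self_nonneg
  linarith [hx.1]

end firstMaxCell

/-- Shrinking the coordinates in `J` does not change the Gaussian measure of an intersection of
few half-spaces by much. -/
theorem measureReal_halfspaces_scaleCoords_ge {ι : Type*} [Fintype ι] [DecidableEq ι] {N : ℕ}
    {u : Fin N → EuclideanSpace ℝ ι} {t : Fin N → ℝ} (hu : ∀ i, u i = 0 ∨ ‖u i‖ = 1)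
    (J : Finset ι) {T r τ : ℝ} (hr1 : r ≤ 1) (hτ : 0 ≤ τ) (hT : 0 ≤ T)
    (hrτ : (1 - r) * T ≤ r * τ) :
    Real.exp (-(τ * T + τ ^ 2 / 2)) *
        ((stdGaussian (EuclideanSpace ℝ ι)).real {x | ∃ i, t i < inner ℝ x (u i)} -
          2 * N * Real.exp (-T ^ 2 / 2)) ≤
      (stdGaussian (EuclideanSpace ℝ ι)).real
        {x | ∃ i, t i < inner ℝ (scaleCoords J r x) (u i)} := by
  set γ := stdGaussian (EuclideanSpace ℝ ι)
  -- The first set is where translation along `u i` is too costly, the second where shrinking loses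
  -- too much. Here `scaleCoords Jᶜ 0` is the projection onto the coordinates in `J`.
  set G := fun i => {x : EuclideanSpace ℝ ι | T < inner ℝ x (u i)} ∪
    {x | T < inner ℝ x (scaleCoords Jᶜ 0 (u i))} with hG
  set D := {x | ∃ i, t i < inner ℝ (scaleCoords J r x) (u i)} with hD
  have hu1 : ∀ i, ‖u i‖ ≤ 1 := fun i => by rcases hu i with h | h <;> simp [h]
  have hGm : ∀ i, MeasurableSet (G i) := fun i =>
    (measurableSet_lt (by fun_prop) (by fun_prop)).union
      (measurableSet_lt (by fun_prop) (by fun_prop))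
  have hDm : MeasurableSet D := by
    have : D = ⋃ i, {x | t i < inner ℝ (scaleCoords J r x) (u i)} := by ext; simp [hD]
    rw [this]
    exact .iUnion fun i => measurableSet_lt (by fun_prop) (by fun_prop)
  have hGr : ∀ i, γ.real (G i) ≤ 2 * Real.exp (-T ^ 2 / 2) := fun i => by
    refine (measureReal_union_le _ _).trans ?_
    linarith [stdGaussian_tail (hu1 i) hT,
      stdGaussian_tail ((norm_scaleCoords_zero_le Jᶜ (u i)).trans (hu1 i)) hT]
  have hcell : ∀ i, Real.exp (-(τ * T + τ ^ 2 / 2)) * γ.real (firstMaxCell u t i \ G i) ≤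
      γ.real (firstMaxCell u t i ∩ D) := by
    intro i
    have hmem : ∀ x ∈ firstMaxCell u t i \ G i,
        inner ℝ x (u i) ≤ T ∧ inner ℝ x (scaleCoords Jᶜ 0 (u i)) ≤ T := fun x hx => by
      simpa [hG, not_or, not_lt] using hx.2
    have := exp_mul_measureReal_le_of_add_mem (τ • u i)
      (A := firstMaxCell u t i \ G i) (C := firstMaxCell u t i ∩ D) (b := τ * T)
      ((measurableSet_firstMaxCell i).diff (hGm i)) (fun x hx => ?_) (fun x hx => ?_)
    · refine le_trans ?_ this
      gcongr
      rw [norm_smul, Real.norm_eq_abs, abs_of_nonneg hτ]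
      exact mul_le_of_le_one_right hτ (hu1 i)
    · refine ⟨add_smul_mem_firstMaxCell hu hτ hx.1, i, ?_⟩
      have h1 := (mem_firstMaxCell.1 hx.1).1
      have h2 := (hmem x hx).2
      rw [inner_scaleCoords]
      simp only [inner_add_left, real_inner_smul_left]
      rcases hu i with h | h
      · have h0 : scaleCoords Jᶜ 0 (0 : EuclideanSpace ℝ ι) = 0 := by
          ext; simp [scaleCoords]
        rw [h] at h1
        rw [h, h0]
        simpa using h1
      · have h3 : inner ℝ (u i) (scaleCoords Jᶜ 0 (u i)) ≤ 1 := by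
          refine (real_inner_le_norm _ _).trans ?_
          have := norm_scaleCoords_zero_le Jᶜ (u i)
          rw [h] at this ⊢
          linarith
        rw [real_inner_self_eq_norm_sq, h]
        have h4 := mul_le_mul_of_nonneg_left h3 hτ
        have h5 := mul_le_mul_of_nonneg_left (add_le_add h2 h4) (sub_nonneg.2 hr1)
        -- Translation gains `τ` and shrinking loses at most `(1 - r) * (T + τ)`; `hrτ` says exactly
        -- that the gain covers the loss.
        linarith
    · rw [real_inner_smul_right]
      exact mul_le_mul_of_nonneg_left (hmem x hx).1 hτ
  have hsum1 : γ.real {x | ∃ i, t i < inner ℝ x (u i)} ≤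
      ∑ i, γ.real (firstMaxCell u t i) := by
    refine le_trans (measureReal_mono (s₂ := ⋃ i, firstMaxCell u t i) fun x hx => ?_)
      (measureReal_iUnion_fintype_le _)
    exact Set.mem_iUnion.2 (exists_mem_firstMaxCell hx)
  have hsum2 : ∑ i, γ.real (firstMaxCell u t i ∩ D) ≤ γ.real D := by
    rw [← measureReal_iUnion_fintype]
    · exact measureReal_mono (Set.iUnion_subset fun i => Set.inter_subset_right)
    · exact fun i j hij => (pairwise_disjoint_firstMaxCell hij).mono Set.inter_subset_left
        Set.inter_subset_left
    · exact fun i => (measurableSet_firstMaxCell i).inter hDm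
  refine le_trans ?_ hsum2
  refine le_trans ?_ (Finset.sum_le_sum fun i _ => hcell i)
  rw [← Finset.mul_sum]
  refine mul_le_mul_of_nonneg_left ?_ (Real.exp_pos _).le
  have hdiff : ∀ i, γ.real (firstMaxCell u t i) - 2 * Real.exp (-T ^ 2 / 2) ≤
      γ.real (firstMaxCell u t i \ G i) := fun i => by
    have : γ.real (firstMaxCell u t i) ≤ γ.real (firstMaxCell u t i \ G i) + γ.real (G i) :=
      (measureReal_mono fun x hx => by by_cases h : x ∈ G i <;> simp [h, hx]).trans
        (measureReal_union_le _ _)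
    linarith [hGr i]
  refine le_trans ?_ (Finset.sum_le_sum fun i _ => hdiff i)
  rw [Finset.sum_sub_distrib, Finset.sum_const, Finset.card_univ, Fintype.card_fin, nsmul_eq_mul]
  linarith

/-- Shrinking the coordinates in `J` does not change the law of a maximum of few affine functions
by much. -/
theorem measureReal_affine_scaleCoords_ge {ι : Type*} [Fintype ι] [DecidableEq ι] {N : ℕ}
    (s : Fin N → EuclideanSpace ℝ ι) (c : Fin N → ℝ) (θ : ℝ)
    (J : Finset ι) {T r τ : ℝ} (hr1 : r ≤ 1) (hτ : 0 ≤ τ) (hT : 0 ≤ T)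
    (hrτ : (1 - r) * T ≤ r * τ) :
    Real.exp (-(τ * T + τ ^ 2 / 2)) *
        ((stdGaussian (EuclideanSpace ℝ ι)).real {x | ∃ i, θ < inner ℝ x (s i) + c i} -
          2 * N * Real.exp (-T ^ 2 / 2)) ≤
      (stdGaussian (EuclideanSpace ℝ ι)).real
        {x | ∃ i, θ < inner ℝ (scaleCoords J r x) (s i) + c i} := by
  -- Normals are rescaled to unit length. For `s i = 0` the half-space is empty or everything, and
  -- any positive factor would do.
  set k := fun i => if s i = 0 then 1 else ‖s i‖⁻¹ with hk
  have hk0 : ∀ i, 0 < k i := fun i => by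
    by_cases h : s i = 0
    · simp [hk, h]
    · simp [hk, h]
  have hu : ∀ i, k i • s i = 0 ∨ ‖k i • s i‖ = 1 := fun i => by
    by_cases h : s i = 0
    · simp [h]
    · right
      rw [norm_smul, Real.norm_eq_abs, abs_of_pos (hk0 i)]
      simp [hk, h]
  have hiff : ∀ i (x : EuclideanSpace ℝ ι),
      k i * (θ - c i) < inner ℝ x (k i • s i) ↔ θ < inner ℝ x (s i) + c i := fun i x => by
    rw [real_inner_smul_right, mul_lt_mul_iff_right₀ (hk0 i), sub_lt_iff_lt_add]
  have := measureReal_halfspaces_scaleCoords_ge (u := fun i => k i • s i)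
    (t := fun i => k i * (θ - c i)) hu J hr1 hτ hT hrτ
  simpa only [hiff] using this

/-! ### The contradiction between superlevel sets of the norm and of few affine functions. -/

theorem sumSq_nonneg {ι : Type*} (J : Finset ι) (x : EuclideanSpace ℝ ι) : 0 ≤ sumSq J x :=
  Finset.sum_nonneg fun _ _ => sq_nonneg _

theorem sumSq_scaleCoords {ι : Type*} [DecidableEq ι] (J : Finset ι) (r : ℝ)
    (x : EuclideanSpace ℝ ι) : sumSq J (scaleCoords J r x) = r ^ 2 * sumSq J x := by
  rw [sumSq, sumSq, Finset.mul_sum]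
  refine Finset.sum_congr rfl fun i hi => ?_
  simp [scaleCoords, hi, mul_pow]

/-- If the super-level sets of a maximum of `N` affine functions are close to those of the
Euclidean norm on `q ^ 2` coordinates, then `N` is exponentially large in `q`. -/
theorem lt_log_card_of_superlevel_close {ι : Type*} [Fintype ι] [DecidableEq ι] {J : Finset ι}
    {q : ℝ} (hq : 100 ≤ q) (hJ : (J.card : ℝ) = q ^ 2) {N : ℕ} (hN : 0 < N)
    (s : Fin N → EuclideanSpace ℝ ι) (c : Fin N → ℝ)
    (h1 : (stdGaussian (EuclideanSpace ℝ ι)).real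
      {x | √(sumSq J x) ≤ q - 6 ∧ ∃ i, q - 5 < inner ℝ x (s i) + c i} ≤ Real.exp (-319))
    (h2 : (stdGaussian (EuclideanSpace ℝ ι)).real
      {x | q - 4 ≤ √(sumSq J x) ∧ ¬ ∃ i, q - 5 < inner ℝ x (s i) + c i} ≤ Real.exp (-319)) :
    q < 100 * Real.log (8 * N) := by
  by_contra! hcon
  set γ := stdGaussian (EuclideanSpace ℝ ι)
  set A := {x : EuclideanSpace ℝ ι | ∃ i, q - 5 < inner ℝ x (s i) + c i} with hA
  have hq0 : 0 < q := by linarith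
  have hN1 : (1 : ℝ) ≤ N := by exact_mod_cast hN
  have hlog : 0 ≤ Real.log (8 * N) := Real.log_nonneg (by linarith)
  have hAm : MeasurableSet A := by
    have : A = ⋃ i, {x | q - 5 < inner ℝ x (s i) + c i} := by ext; simp [hA]
    rw [this]
    exact .iUnion fun i => measurableSet_lt (by fun_prop) (by fun_prop)
  -- Chosen so that the discarded mass `2 * N * exp (-T ^ 2 / 2)` equals `1 / 4`.
  set T := √(2 * Real.log (8 * N))
  have hT0 : 0 ≤ T := Real.sqrt_nonneg _
  have hT2 : T ^ 2 = 2 * Real.log (8 * N) := Real.sq_sqrt (by positivity)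
  -- Large enough to pull the norm from about `q` to below `q - 6`, and small enough that `l * T ^ 2
  -- ≤ 1 / 2` under `hcon`.
  set l := 25 / q with hl
  have hl0 : 0 < l := by positivity
  have hl1 : l ≤ 1 := by rw [hl, div_le_one hq0]; linarith
  have hlT : l * T ^ 2 ≤ 1 / 2 := by
    rw [hT2, hl, div_mul_eq_mul_div, div_le_iff₀ hq0]
    linarith
  have hs1 : 1 ≤ √(1 + l) := Real.one_le_sqrt.2 (by linarith)
  have hs2 : √(1 + l) ≤ 1 + l / 2 := by
    apply Real.sqrt_le_iff.2
    constructor <;> nlinarith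
  have hexp : Real.exp (-3) ≤ 1 / 16 := by
    rw [Real.exp_neg, inv_eq_one_div]
    refine one_div_le_one_div_of_le (by norm_num) ?_
    have h := Real.exp_one_gt_d9
    calc (16 : ℝ) ≤ 2.7 ^ 3 := by norm_num
      _ ≤ Real.exp 1 ^ 3 := by gcongr; linarith
      _ = Real.exp 3 := by rw [← Real.exp_nat_mul]; norm_num
  have hexp' : ∀ v ≤ (-3 : ℝ), Real.exp v ≤ 1 / 16 := fun v hv =>
    (Real.exp_le_exp.2 hv).trans hexp
  have key := measureReal_affine_scaleCoords_ge s c (q - 5) J (r := (√(1 + l))⁻¹)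
    (τ := l / 2 * T) (inv_le_one_of_one_le₀ hs1) (by positivity) hT0 (by
      have h0 : 0 < √(1 + l) := by linarith
      have h3 : (1 - (√(1 + l))⁻¹) * T = (√(1 + l))⁻¹ * ((√(1 + l) - 1) * T) := by
        field_simp
      rw [h3]
      gcongr
      linarith)
  have e1 : 2 * N * Real.exp (-T ^ 2 / 2) = 1 / 4 := by
    have : -T ^ 2 / 2 = -Real.log (8 * N) := by rw [neg_div, hT2]; ring
    rw [this, Real.exp_neg, Real.exp_log (by linarith)]
    have : (N : ℝ) ≠ 0 := by linarith
    field_simp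
    norm_num
  have e2 : 1 / 2 ≤ Real.exp (-(l / 2 * T * T + (l / 2 * T) ^ 2 / 2)) := by
    have := Real.add_one_le_exp (-(l / 2 * T * T + (l / 2 * T) ^ 2 / 2))
    have h3 : l * (l * T ^ 2) ≤ 1 * (l * T ^ 2) := by gcongr
    nlinarith
  have hlow : 7 / 8 ≤ γ.real A := by
    have hc : γ.real Aᶜ = 1 - γ.real A := probReal_compl_eq_one_sub hAm
    have hc2 : γ.real Aᶜ ≤ γ.real {x | √(sumSq J x) ≤ q - 4} +
        γ.real {x | q - 4 ≤ √(sumSq J x) ∧ ¬ ∃ i, q - 5 < inner ℝ x (s i) + c i} := by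
      refine (measureReal_mono fun x hx => ?_).trans (measureReal_union_le _ _)
      rcases le_total (√(sumSq J x)) (q - 4) with h | h
      · exact .inl h
      · exact .inr ⟨h, hx⟩
    have hc3 : γ.real {x | √(sumSq J x) ≤ q - 4} ≤ 1 / 16 := by
      refine (measureReal_sumSq_lower_tail (C := 7) hq0 hJ (by norm_num) fun x hx => ?_).trans
        (hexp' _ (by norm_num))
      have := (Real.sqrt_le_left (by linarith)).1 hx
      nlinarith
    linarith [hexp' (-319) (by norm_num)]
  have hup : γ.real (scaleCoords J (√(1 + l))⁻¹ ⁻¹' A) ≤ 3 / 16 := by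
    set B := {x | √(sumSq J x) ≤ q - 6 ∧ ∃ i, q - 5 < inner ℝ x (s i) + c i} with hB
    have hBm : MeasurableSet B :=
      (measurableSet_le (f := fun x => √(sumSq J x)) (g := fun _ => q - 6) (by fun_prop)
        (by fun_prop)).inter hAm
    have hc2 : γ.real (scaleCoords J (√(1 + l))⁻¹ ⁻¹' A) ≤
        γ.real {x | q - 6 ≤ √(sumSq J (scaleCoords J (√(1 + l))⁻¹ x))} +
        γ.real (scaleCoords J (√(1 + l))⁻¹ ⁻¹' B) := by
      refine (measureReal_mono fun x hx => ?_).trans (measureReal_union_le _ _)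
      rcases le_total (√(sumSq J (scaleCoords J (√(1 + l))⁻¹ x))) (q - 6) with h | h
      · exact .inr ⟨h, hx⟩
      · exact .inl h
    have hc3 : γ.real {x | q - 6 ≤ √(sumSq J (scaleCoords J (√(1 + l))⁻¹ x))} ≤ 1 / 16 := by
      refine (measureReal_sumSq_upper_tail (C := 8) hq0 hJ (by norm_num) (by linarith)
        fun x hx => ?_).trans (hexp' _ (by norm_num))
      have hx' := (Real.le_sqrt' (by linarith)).1 hx
      rw [sumSq_scaleCoords, inv_pow, Real.sq_sqrt (by linarith), inv_mul_eq_div,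
        le_div_iff₀ (by linarith)] at hx'
      refine le_trans ?_ hx'
      have hlq : l * q = 25 := div_mul_cancel₀ _ hq0.ne'
      have : (q - 6) ^ 2 * (1 + l) = (q - 6) ^ 2 + (l * q) * (q - 12) + 36 * l := by ring
      rw [this, hlq]
      nlinarith
    have hc4 := measureReal_preimage_scaleCoords_le (J := J) hl0.le (Real.exp_pos 316) hBm
    have e3 : (J.card : ℝ) * l ^ 2 / 2 = 625 / 2 := by
      rw [hJ, hl]
      field_simp
      norm_num
    rw [e3, ← Real.exp_sub] at hc4
    have e4 : Real.exp 316 * γ.real B ≤ 1 / 16 := by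
      refine (mul_le_mul_of_nonneg_left h1 (Real.exp_pos 316).le).trans ?_
      rw [← Real.exp_add]
      exact hexp' _ (by norm_num)
    linarith [hexp' (625 / 2 - 316) (by norm_num)]
  rw [e1] at key
  -- With `7 / 8 ≤ γ.real A` the left side is at least `5 / 16`.
  have key2 : 1 / 2 * (γ.real A - 1 / 4) ≤ 3 / 16 :=
    (mul_le_mul_of_nonneg_right e2 (by linarith)).trans (key.trans hup)
  linarith

theorem lintegral_sqrt_sumSq_le {ι : Type*} [Fintype ι] {J : Finset ι}
    {q : ℝ} (hq : 2 ≤ q) (hJ : (J.card : ℝ) = q ^ 2) :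
    ∫⁻ x, ENNReal.ofReal √(sumSq J x) ∂stdGaussian (EuclideanSpace ℝ ι) ≤
      ENNReal.ofReal (4 * q) := by
  have hq0 : 0 < q := by linarith
  set l := 1 / q ^ 2 with hl
  have hl0 : 0 < l := by positivity
  have hl1 : l ≤ 1 / 4 := by
    rw [hl]
    exact one_div_le_one_div_of_le (by norm_num) (by nlinarith)
  have h := lintegral_stdGaussian_exp_sumSq J (by linarith : -1 < -l)
  set P := √(1 + -l) ^ J.card
  have hP : Real.exp (-1) ≤ P := by
    refine le_trans (Real.exp_le_exp.2 ?_) (exp_le_sqrt_one_add_pow (by linarith) J.card)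
    have : q ^ 2 * l = 1 := by rw [hl]; field_simp
    rw [hJ]
    have h3 : q ^ 2 * ((-l - (-l) ^ 2) / 2) = -(q ^ 2 * l) * (1 + l) / 2 := by ring
    rw [h3, this]
    linarith
  have hP3 : 1 ≤ 3 * P := by
    have : (1 : ℝ) / 3 ≤ Real.exp (-1) := by
      rw [Real.exp_neg, inv_eq_one_div]
      exact one_div_le_one_div_of_le (Real.exp_pos 1) (by linarith [Real.exp_one_lt_d9])
    linarith
  have hpt : ∀ x : EuclideanSpace ℝ ι, √(sumSq J x) ≤
      q + 3 * q * (P * Real.exp (-(-l * sumSq J x) / 2)) := by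
    intro x
    have h0 := sumSq_nonneg J x
    have h1 : √(sumSq J x) ≤ q + sumSq J x / q / 2 := by
      have h2 : √(sumSq J x) ^ 2 = sumSq J x := Real.sq_sqrt h0
      have : q + sumSq J x / q / 2 - √(sumSq J x) =
          ((√(sumSq J x) - q) ^ 2 + q ^ 2) / (2 * q) := by
        rw [sub_sq, h2]
        field_simp
        ring
      have h3 : 0 ≤ ((√(sumSq J x) - q) ^ 2 + q ^ 2) / (2 * q) := by positivity
      linarith
    have h4 := Real.add_one_le_exp (-(-l * sumSq J x) / 2)
    have h5 : sumSq J x / q / 2 = q * (-(-l * sumSq J x) / 2) := by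
      rw [hl]
      field_simp
    have h6 : Real.exp (-(-l * sumSq J x) / 2) ≤
        3 * P * Real.exp (-(-l * sumSq J x) / 2) :=
      le_mul_of_one_le_left (Real.exp_pos _).le hP3
    have h7 : q * (-(-l * sumSq J x) / 2) ≤
        q * (3 * P * Real.exp (-(-l * sumSq J x) / 2)) := by
      gcongr
      linarith
    linarith
  calc _ ≤ ∫⁻ x, (ENNReal.ofReal q + ENNReal.ofReal (3 * q) *
        ENNReal.ofReal (P * Real.exp (-(-l * sumSq J x) / 2)))
          ∂stdGaussian (EuclideanSpace ℝ ι) := by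
        refine lintegral_mono fun x => ?_
        rw [← ENNReal.ofReal_mul (by positivity), ← ENNReal.ofReal_add hq0.le (by positivity)]
        exact ENNReal.ofReal_le_ofReal (hpt x)
    _ = ENNReal.ofReal (4 * q) := by
        rw [lintegral_add_left measurable_const, lintegral_const_mul' _ _ ENNReal.ofReal_ne_top, h,
          lintegral_const, measure_univ, mul_one, mul_one,
          ← ENNReal.ofReal_add hq0.le (by positivity)]
        congr 1
        ring

theorem integrable_sqrt_sumSq {ι : Type*} [Fintype ι] {J : Finset ι}
    {q : ℝ} (hq : 2 ≤ q) (hJ : (J.card : ℝ) = q ^ 2) :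
    Integrable (fun x => √(sumSq J x)) (stdGaussian (EuclideanSpace ℝ ι)) := by
  refine ⟨by fun_prop, ?_⟩
  rw [hasFiniteIntegral_iff_ofReal (ae_of_all _ fun x => Real.sqrt_nonneg _)]
  exact (lintegral_sqrt_sumSq_le hq hJ).trans_lt ENNReal.ofReal_lt_top

theorem integral_sqrt_sumSq_le {ι : Type*} [Fintype ι] {J : Finset ι}
    {q : ℝ} (hq : 2 ≤ q) (hJ : (J.card : ℝ) = q ^ 2) :
    ∫ x, √(sumSq J x) ∂stdGaussian (EuclideanSpace ℝ ι) ≤ 4 * q := by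
  rw [integral_eq_lintegral_of_nonneg_ae (ae_of_all _ fun x => Real.sqrt_nonneg _) (by fun_prop)]
  exact ENNReal.toReal_le_of_le_ofReal (by linarith) (lintegral_sqrt_sumSq_le hq hJ)

theorem integral_sqrt_sumSq_pos {ι : Type*} [Fintype ι] {J : Finset ι}
    {q : ℝ} (hq : 2 ≤ q) (hJ : (J.card : ℝ) = q ^ 2) :
    0 < ∫ x, √(sumSq J x) ∂stdGaussian (EuclideanSpace ℝ ι) := by
  have hq0 : 0 < q := by linarith
  rw [integral_pos_iff_support_of_nonneg (fun x => Real.sqrt_nonneg _)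
    (integrable_sqrt_sumSq hq hJ)]
  by_contra! h0
  have h1 : (stdGaussian (EuclideanSpace ℝ ι)).real {x | √(sumSq J x) = 0} = 1 := by
    have hm : MeasurableSet {x : EuclideanSpace ℝ ι | √(sumSq J x) = 0} :=
      measurableSet_eq_fun (by fun_prop) (by fun_prop)
    have hc := probReal_compl_eq_one_sub (μ := stdGaussian (EuclideanSpace ℝ ι)) hm
    have : (stdGaussian (EuclideanSpace ℝ ι)).real {x | √(sumSq J x) = 0}ᶜ = 0 := by
      rw [measureReal_def]
      exact (ENNReal.toReal_eq_zero_iff _).2 (.inl (nonpos_iff_eq_zero.1 h0))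
    linarith
  have h2 := measureReal_sumSq_lower_tail (C := q) hq0 hJ hq0.le
    (A := {x : EuclideanSpace ℝ ι | √(sumSq J x) = 0}) fun x hx => by
      rw [(Real.sqrt_eq_zero (sumSq_nonneg J x)).1 hx]
      nlinarith
  have h3 : Real.exp (-(q ^ 2 / 8)) < 1 := by
    rw [← Real.exp_zero]
    exact Real.exp_lt_exp.2 (by nlinarith)
  linarith

section coordBall

variable {n : ℕ} (J : Finset (Fin n))

/-- The ball of radius `ρ` in the subspace spanned by the coordinates in `J`. -/
def coordBall (ρ : ℝ) : Set (EuclideanSpace ℝ (Fin n)) :=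
  {t | ‖t‖ ≤ ρ ∧ ∀ i ∉ J, t i = 0}

theorem isBounded_coordBall (ρ : ℝ) : Bornology.IsBounded (coordBall J ρ) :=
  isBounded_iff_forall_norm_le.2 ⟨ρ, fun _ ht => ht.1⟩

theorem coordBall_nonempty {ρ : ℝ} (hρ : 0 ≤ ρ) : (coordBall J ρ).Nonempty :=
  ⟨0, by simpa [coordBall] using hρ⟩

theorem norm_scaleCoords_compl_zero (x : EuclideanSpace ℝ (Fin n)) :
    ‖scaleCoords Jᶜ 0 x‖ = √(sumSq J x) := by
  rw [EuclideanSpace.norm_eq, sumSq]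
  congr 1
  rw [← Finset.sum_subset (Finset.subset_univ J)]
  · refine Finset.sum_congr rfl fun i hi => ?_
    simp [scaleCoords, hi]
  · intro i _ hi
    simp [scaleCoords, hi]

theorem supFun_coordBall {ρ : ℝ} (hρ : 0 ≤ ρ) (x : EuclideanSpace ℝ (Fin n)) :
    supFun (coordBall J ρ) x = ρ * √(sumSq J x) := by
  set p := scaleCoords Jᶜ 0 x with hp
  have hinner : ∀ t ∈ coordBall J ρ, inner ℝ x t = inner ℝ p t := by
    intro t ht
    simp only [PiLp.inner_apply, RCLike.inner_apply, conj_trivial, hp, scaleCoords]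
    refine Finset.sum_congr rfl fun i _ => ?_
    by_cases h : i ∈ J
    · simp [h]
    · simp [ht.2 i h]
  have hle : ∀ t : coordBall J ρ, inner ℝ x (t : EuclideanSpace ℝ (Fin n)) ≤ ρ * ‖p‖ := by
    rintro ⟨t, ht⟩
    rw [hinner t ht, mul_comm]
    exact (real_inner_le_norm _ _).trans (mul_le_mul_of_nonneg_left ht.1 (norm_nonneg _))
  rw [← norm_scaleCoords_compl_zero, ← hp]
  have : Nonempty (coordBall J ρ) := (coordBall_nonempty J hρ).to_subtype
  refine le_antisymm (ciSup_le hle) ?_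
  have hmem : (ρ * ‖p‖⁻¹) • p ∈ coordBall J ρ := by
    refine ⟨?_, fun i hi => by simp [hp, scaleCoords, hi]⟩
    rw [norm_smul, Real.norm_eq_abs, abs_of_nonneg (by positivity), mul_assoc]
    exact mul_le_of_le_one_right hρ inv_mul_le_one
  refine le_trans (le_of_eq ?_) (le_ciSup ⟨ρ * ‖p‖, Set.forall_mem_range.2 hle⟩ ⟨_, hmem⟩)
  rw [hinner _ hmem, real_inner_smul_right, real_inner_self_eq_norm_sq]
  rcases eq_or_ne ‖p‖ 0 with h | h
  · simp [h]
  · field_simp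

end coordBall

theorem measureReal_le_of_lintegral_abs_sub_le {Ω : Type*} [MeasurableSpace Ω] {μ : Measure Ω}
    {f : Ω → ℝ} (hf : Measurable f) {ε ρ : ℝ} (hε : 0 ≤ ε) (hρ : 0 < ρ)
    (h : ∫⁻ x, ENNReal.ofReal |f x| ∂μ ≤ ENNReal.ofReal ε) {A : Set Ω} (hA : ∀ x ∈ A, ρ ≤ |f x|) :
    μ.real A ≤ ε / ρ := by
  have h1 := mul_meas_ge_le_lintegral (μ := μ) (f := fun x => ENNReal.ofReal |f x|)
    (by fun_prop) (ENNReal.ofReal ρ)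
  have h2 : ENNReal.ofReal ρ * μ A ≤ ENNReal.ofReal ε := by
    refine le_trans ?_ (h1.trans h)
    gcongr
    exact fun x hx => ENNReal.ofReal_le_ofReal (hA x hx)
  have h3 := ENNReal.toReal_mono ENNReal.ofReal_ne_top h2
  rw [ENNReal.toReal_mul, ENNReal.toReal_ofReal hρ.le, ENNReal.toReal_ofReal hε] at h3
  rw [le_div_iff₀ hρ, mul_comm]
  exact h3

/-- A maximum of `N` affine functions that is close in `L¹` to the normalized Euclidean norm
on `q ^ 2` coordinates has exponentially many pieces. -/
theorem lt_log_ncard_of_lintegral_le {n : ℕ} {J : Finset (Fin n)} {q : ℝ} (hq : 100 ≤ q)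
    (hJ : (J.card : ℝ) = q ^ 2) {ε w : ℝ} (hε : 0 ≤ ε) (hw : 0 < w) (hwq : w ≤ 4 * q)
    (hεq : 4 * q * ε ≤ Real.exp (-319)) {S : Set (EuclideanSpace ℝ (Fin n))} (c : S → ℝ)
    (hS : S.Finite) (hne : S.Nonempty)
    (h : ∫⁻ g, ENNReal.ofReal |supFun (coordBall J w⁻¹) g - shiftedSup S c g|
      ∂(stdGaussian (EuclideanSpace ℝ (Fin n))) ≤ ENNReal.ofReal ε) :
    q < 100 * Real.log (8 * S.ncard) := by
  have := hS.to_subtype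
  have := hne.to_subtype
  have hw' : 0 < w⁻¹ := inv_pos.2 hw
  let e : Fin S.ncard ≃ S := (Finite.equivFinOfCardEq (Nat.card_coe_set_eq S)).symm
  have hlt : ∀ (a : ℝ) x, (∃ i, w * a < inner ℝ x (w • (e i : EuclideanSpace ℝ (Fin n)))
      + w * c (e i)) ↔ a < shiftedSup S c x := by
    intro a x
    rw [shiftedSup, lt_ciSup_iff (Set.finite_range _).bddAbove, e.exists_congr_left]
    refine exists_congr fun i => ?_
    rw [real_inner_smul_right, ← mul_add, mul_lt_mul_iff_right₀ hw]
    simp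
  have hlt' : ∀ x, (∃ i, q - 5 < inner ℝ x (w • (e i : EuclideanSpace ℝ (Fin n)))
      + w * c (e i)) ↔ w⁻¹ * (q - 5) < shiftedSup S c x := fun x => by
    rw [← hlt, mul_inv_cancel_left₀ hw.ne']
  have hmeas : Measurable (shiftedSup S c) :=
    Measurable.iSup fun s => by fun_prop
  have hm : Measurable fun g => supFun (coordBall J w⁻¹) g - shiftedSup S c g := by
    simp_rw [supFun_coordBall J hw'.le]
    fun_prop
  have hsmall : ε / w⁻¹ ≤ Real.exp (-319) := by
    rw [div_inv_eq_mul, mul_comm]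
    exact (mul_le_mul_of_nonneg_right hwq hε).trans hεq
  refine lt_log_card_of_superlevel_close hq hJ ((Set.ncard_pos hS).2 hne)
    (fun i => w • (e i : EuclideanSpace ℝ (Fin n))) (fun i => w * c (e i)) ?_ ?_
  · refine (measureReal_le_of_lintegral_abs_sub_le hm hε hw' h fun x hx => ?_).trans hsmall
    have h1 := (hlt' x).1 hx.2
    have h2 := mul_le_mul_of_nonneg_left hx.1 hw'.le
    rw [supFun_coordBall J hw'.le, le_abs]
    right
    linarith
  · refine (measureReal_le_of_lintegral_abs_sub_le hm hε hw' h fun x hx => ?_).trans hsmall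
    have h1 := not_lt.1 fun h' => hx.2 ((hlt' x).2 h')
    have h2 := mul_le_mul_of_nonneg_left hx.1 hw'.le
    rw [supFun_coordBall J hw'.le, le_abs]
    left
    linarith

theorem corollary6p4 :
    ∃ h : ℝ → ℝ, IsTildeOmega (𝓝[>] 0) h (fun ε => 1 / Real.sqrt ε) ∧
      ∀ ε : ℝ, 0 < ε → ∃ n₀ : ℕ, ∀ n : ℕ, n₀ ≤ n →
        ∃ T : Set (EuclideanSpace ℝ (Fin n)),
          T.Nonempty ∧ Bornology.IsBounded T ∧ gaussianWidth T = 1 ∧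
          ∀ (S : Set (EuclideanSpace ℝ (Fin n))) (c : S → ℝ), S.Nonempty →
            ∫⁻ g, ENNReal.ofReal |supFun T g - shiftedSup S c g|
                ∂(stdGaussian (EuclideanSpace ℝ (Fin n))) ≤ ENNReal.ofReal ε →
            ENNReal.ofReal ((2 : ℝ) ^ h ε) ≤ ((S.encard : ℕ∞) : ℝ≥0∞) := by
  set κ : ℝ := Real.exp (-319) / 4 with hκ
  have hκ0 : 0 < κ := by positivity
  have hκ1 : κ ≤ 1 := by
    have : Real.exp (-319) ≤ 1 := Real.exp_le_one_iff.2 (by norm_num)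
    linarith
  refine ⟨fun ε => if 401 / κ ≤ 1 / √ε then 1 / √ε else 0, ⟨1, one_pos, 0, ?_⟩, fun ε hε => ?_⟩
  · have ht : Tendsto (fun ε : ℝ => 1 / √ε) (𝓝[>] 0) atTop := by
      simp_rw [one_div]
      refine tendsto_inv_nhdsGT_zero.comp (tendsto_nhdsWithin_iff.2 ⟨?_, ?_⟩)
      · have := (Real.continuous_sqrt.tendsto 0).mono_left (nhdsWithin_le_nhds (s := Set.Ioi 0))
        rwa [Real.sqrt_zero] at this
      · filter_upwards [self_mem_nhdsWithin] with x hx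
        exact Real.sqrt_pos.2 hx
    filter_upwards [ht.eventually_ge_atTop (401 / κ)] with x hx
    simp only [hx, if_true, pow_zero, div_one, one_mul, le_refl]
  obtain ⟨q, hq2, hq⟩ : ∃ q : ℕ, 2 ≤ q ∧ (401 / κ ≤ 1 / √ε → (100 : ℝ) ≤ q ∧
      4 * q * ε ≤ Real.exp (-319) ∧ 300 + 100 * (1 / √ε) ≤ q) := by
    by_cases hy : 401 / κ ≤ 1 / √ε
    · have hy1 : 1 ≤ 1 / √ε := by
        refine le_trans ?_ hy
        rw [le_div_iff₀ hκ0]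
        linarith
      have hy2 : (1 / √ε) ^ 2 = 1 / ε := by rw [div_pow, Real.sq_sqrt hε.le, one_pow]
      have hfl := Nat.lt_floor_add_one (κ / ε)
      have hq : 300 + 100 * (1 / √ε) ≤ (⌊κ / ε⌋₊ : ℝ) := by
        have h1 : 401 * (1 / √ε) ≤ κ / ε := by
          rw [div_le_iff₀ hκ0] at hy
          calc 401 * (1 / √ε) ≤ 1 / √ε * κ * (1 / √ε) := by gcongr
            _ = κ * (1 / √ε) ^ 2 := by ring
            _ = κ / ε := by rw [hy2]; ring
        linarith
      have hq100 : (100 : ℝ) ≤ (⌊κ / ε⌋₊ : ℝ) := by linarith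
      refine ⟨⌊κ / ε⌋₊, ?_, fun _ => ⟨hq100, ?_, hq⟩⟩
      · have : (2 : ℝ) ≤ (⌊κ / ε⌋₊ : ℝ) := by linarith
        exact_mod_cast this
      · have := Nat.floor_le (div_nonneg hκ0.le hε.le)
        rw [le_div_iff₀ hε] at this
        linarith
    · exact ⟨2, le_rfl, fun h => absurd h hy⟩
  have hq2' : (2 : ℝ) ≤ q := by exact_mod_cast hq2
  refine ⟨q ^ 2, fun n hn => ?_⟩
  obtain ⟨J, -, hJ⟩ := Finset.exists_subset_card_eq (s := (Finset.univ : Finset (Fin n)))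
    (n := q ^ 2) (by simpa using hn)
  have hJ' : (J.card : ℝ) = (q : ℝ) ^ 2 := by rw [hJ]; push_cast; rfl
  have hw := integral_sqrt_sumSq_pos hq2' hJ'
  have hwq := integral_sqrt_sumSq_le hq2' hJ'
  set w := ∫ x, √(sumSq J x) ∂stdGaussian (EuclideanSpace ℝ (Fin n)) with hwdef
  refine ⟨coordBall J w⁻¹, coordBall_nonempty J (inv_pos.2 hw).le, isBounded_coordBall J _, ?_, ?_⟩
  · rw [gaussianWidth]
    simp_rw [supFun_coordBall J (inv_pos.2 hw).le]
    rw [integral_const_mul, ← hwdef, inv_mul_cancel₀ hw.ne']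
  intro S c hne hint
  rcases S.finite_or_infinite with hS | hS
  swap
  · simp [hS.encard_eq]
  have hN : 0 < S.ncard := (Set.ncard_pos hS).2 hne
  have hN1 : (1 : ℝ) ≤ S.ncard := by exact_mod_cast hN
  rw [← hS.cast_ncard_eq, ENat.toENNReal_coe, ← ENNReal.ofReal_natCast]
  refine ENNReal.ofReal_le_ofReal ?_
  by_cases hy : 401 / κ ≤ 1 / √ε
  swap
  · simpa only [hy, if_false, Real.rpow_zero] using hN1
  simp only [hy, if_true]
  obtain ⟨hq100, hεq, hqy⟩ := hq hy
  have hlog := lt_log_ncard_of_lintegral_le hq100 hJ' hε.le hw hwq hεq c hS hne hint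
  rw [Real.log_mul (by norm_num) (by linarith)] at hlog
  have h8 : Real.log 8 ≤ 3 := by
    rw [show (8 : ℝ) = 2 ^ 3 by norm_num, Real.log_pow]
    push_cast
    linarith [Real.log_two_lt_d9]
  rw [Real.rpow_def_of_pos two_pos, ← Real.le_log_iff_exp_le (by linarith)]
  have h2 : Real.log 2 * (1 / √ε) ≤ 1 * (1 / √ε) := by
    gcongr
    linarith [Real.log_two_lt_d9]
  linarith
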